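/- A differential valued exponential field is a field $K$ of characteristic $0$ equipped with a derivation $D:K\to K$, a valuation $v$ with valuation ring $\mathcal O_v$ and maximal ideal $\mathcal M_v$, and a map $\exp:K\to K^\times$ such that $\exp(x+y)=\exp(x)\exp(y)$ and $Dx=D(\exp x)/\exp x$ for all $x,y\in K$, and such that the field of constants $C=\{c\in K: Dc=0\}$ is contained in $\mathcal O_v$ and maps isomorphically onto the residue field $\mathcal O_v/\mathcal M_v$, i.e. $\mathcal O_v=C\oplus\mathcal M_v$. For $y\in\mathcal O_v$ let $\bar y$ denote the unique $c\in C$ with $y-c\in\mathcal M_v$. Let $K$ be a differential valued exponential field, and let $A$ be a complement of $\mathcal O_v$ in the $\mathbb Q$-vector space $K$, so that $K=A\oplus C\oplus\mathcal M_v$. For $y\in K$ put $\mathrm{co}_A(y):=\overline{y-a}\in C$, where $a$ is the unique element of $A$ with $y-a\in\mathcal O_v$. Let $n\ge 1$ and let $y_1,\dots,y_n\in K$ be such that $$y_1-\mathrm{co}_A(y_1),\ \dots,\ y_n-\mathrm{co}_A(y_n)$$ are $\mathbb Q$-linearly independent. Then $$\mathrm{td}_C\, C\bigl(y_1,\dots,y_n,\exp(y_1),\dots,\exp(y_n)\bigr)\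 \ge\ n+1,$$ where $\mathrm{td}_C$ denotes the transcendence degree over $C$. -/

import Mathlib

/-- A differential valued exponential field structure on a field `K` of characteristic `0`:
a derivation `D`, a valuation `v` (written multiplicatively, so that the valuation ring is
`{y | v y ≤ 1}` and its maximal ideal is `{y | v y < 1}`) and an exponential `exp : K → Kˣ`. -/
structure DiffValExpField (K : Type*) [Field K] [CharZero K]
    (Γ₀ : Type*) [LinearOrderedCommGroupWithZero Γ₀] where
  /-- The derivation. -/
  D : Derivation ℤ K K
  /-- The valuation. -/
  v : Valuation K Γ₀
  /-- The exponential map. -/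
  exp : K → Kˣ
  exp_add : ∀ x y : K, exp (x + y) = exp x * exp y
  D_eq_logDeriv_exp : ∀ x : K, D x = D (exp x : K) / (exp x : K)
  /-- Together with the next field: the field of constants is contained in the valuation ring and
  is mapped bijectively onto the residue field. -/
  constant_mem : ∀ c : K, D c = 0 → v c ≤ 1
  existsUnique_constant : ∀ y : K, v y ≤ 1 → ∃! c : K, D c = 0 ∧ v (y - c) < 1

namespace DiffValExpField

variable {K : Type*} [Field K] [CharZero K] {Γ₀ : Type*} [LinearOrderedCommGroupWithZero Γ₀]

/-- The field of constants `C = {c | D c = 0}`. -/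
def constants (S : DiffValExpField K Γ₀) : Subfield K where
  carrier := {c | S.D c = 0}
  mul_mem' := by
    intro a b ha hb
    simp only [Set.mem_ofPred_eq] at ha hb ⊢
    simp [Derivation.leibniz, ha, hb]
  one_mem' := by simp
  add_mem' := by
    intro a b ha hb
    simp only [Set.mem_ofPred_eq] at ha hb ⊢
    simp [ha, hb]
  zero_mem' := by simp
  neg_mem' := by
    intro a ha
    simp only [Set.mem_ofPred_eq] at ha ⊢
    simp [ha]
  inv_mem' := by
    intro a ha
    simp only [Set.mem_ofPred_eq] at ha ⊢
    simp [Derivation.leibniz_inv, ha]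

/-- The valuation ring `𝒪_v`, as a `ℚ`-linear subspace of `K`. -/
def valuationRing (S : DiffValExpField K Γ₀) : Submodule ℚ K where
  carrier := {y | S.v y ≤ 1}
  add_mem' := by
    intro a b ha hb
    exact S.v.map_add_le ha hb
  zero_mem' := by simp
  smul_mem' := by
    intro q y hy
    have hq : S.v (q : K) ≤ 1 := S.constant_mem _ (SubfieldClass.ratCast_mem S.constants q)
    simp only [Set.mem_ofPred_eq] at hy ⊢
    rw [Rat.smul_def, map_mul]
    exact mul_le_one' hq hy

/-- The residue of an element `y` of the valuation ring: the unique constant `c` such that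
`y - c` lies in the maximal ideal. -/
noncomputable def residue (S : DiffValExpField K Γ₀) (y : S.valuationRing) : S.constants :=
  ⟨(S.existsUnique_constant y y.2).choose, (S.existsUnique_constant y y.2).choose_spec.1.1⟩

/-- The constant coefficient `co_A(y)` of `y ∈ K` relative to a `ℚ`-linear complement `A` of the
valuation ring: the residue of `y - a`, where `a` is the component of `y` in `A`, i.e. of the
projection of `y` to the valuation ring along `A`. -/
noncomputable def co (S : DiffValExpField K Γ₀) (A : Submodule ℚ K)
    (hA : IsCompl A S.valuationRing) (y : K) : S.constants :=
  S.residue (Submodule.projectionOnto S.valuationRing A hA.symm y)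

end DiffValExpField

/-!
Since `co_A` is additive and is the identity on constants, the hypothesis implies that the `yᵢ` are
`ℚ`-linearly independent modulo the constants `C`, and the theorem is Ax's theorem
(`DiffValExpField.le_trdeg_adjoin_exp`), whose proof is differential-algebraic. Write
`zᵢ = exp yᵢ` and suppose that the transcendence degree is at most `n`.

Consider the forms `ωᵢ = dyᵢ - dzᵢ/zᵢ` in `Ω[K⁄C]`, tested on derivations of `K` over `C`. They
depend only on the restriction of a derivation to `C(y, z)`, which leaves at most `n` degrees of
freedom, and all of them kill `D`, which is nonzero there. So the `ωᵢ` are linearly dependent over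
`K` (`finrank_range_expDefect_lt`). The Lie derivative of `ωᵢ` along `D` is zero, hence the space
of linear relations is stable under `D`, and a relation of minimal support, normalized, has
constant coefficients (`Submodule.exists_constant_vector`).

A relation `∑ cᵢ ωᵢ = 0` with constant `cᵢ` says that `∑ cᵢ dzᵢ/zᵢ` is exact. Expressing the `cᵢ`
in a `ℤ`-basis `eⱼ` of the group that they generate turns it into `∑ eⱼ dwⱼ/wⱼ`, where the `wⱼ` are
exponentials of `ℤ`-combinations of the `yᵢ`. Then every `wⱼ` is algebraic over `C`
(`isAlgebraic_of_sum_logDeriv_exact`): if `wⱼ` were transcendental, `K` would embed over `C` into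
the algebraic closure of `K((X))` with `wⱼ ↦ X`; pulling back an extension of `X d/dX` and taking
the trace down to `K((X))` from a finite Galois extension gives an exact combination of logarithmic
derivatives whose residue is a `ℤ`-combination of the `eⱼ` with a positive coefficient at `eⱼ`,
while an exact form has residue zero. So `D wⱼ = 0`, the exponents are constants, and by
independence all coefficients vanish.
-/

open scoped TensorProduct LaurentSeries

/-! ### Derivations of fields -/

section Derivations

/-- In characteristic zero a derivation vanishes on everything algebraic over the base field. -/
theorem Derivation.eq_zero_of_isAlgebraic {k F M : Type*} [Field k] [CharZero k] [Field F]
    [Algebra k F] [AddCommGroup M] [Module k M] [Module F M] (δ : Derivation k F M) {x : F}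
    (hx : IsAlgebraic k x) : δ x = 0 := by
  have h := δ.map_aeval (minpoly k x) x
  rw [minpoly.aeval, map_zero] at h
  have hsep : (minpoly k x).Separable := (minpoly.irreducible hx.isIntegral).separable
  exact (smul_eq_zero.1 h.symm).resolve_left
    (hsep.aeval_derivative_ne_zero (minpoly.aeval k x))

/-- In characteristic zero a derivation is determined by its values on a transcendence basis. -/
theorem Derivation.eq_zero_of_isTranscendenceBasis {C F M ι : Type*} [Field C] [CharZero C]
    [Field F] [Algebra C F] [AddCommGroup M] [Module C M] [Module F M] (δ : Derivation C F M)
    {x : ι → F} (hx : IsTranscendenceBasis C x) (h : ∀ i, δ (x i) = 0) (a : F) : δ a = 0 := by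
  have h0 : ∀ a ∈ IntermediateField.adjoin C (Set.range x), δ a = 0 := by
    intro a ha
    induction ha using IntermediateField.adjoin_induction with
    | mem a ha => obtain ⟨i, rfl⟩ := ha; exact h i
    | algebraMap c => simp
    | add a b _ _ ha hb => simp [ha, hb]
    | inv a _ ha => simp [Derivation.leibniz_inv, ha]
    | mul a b _ _ ha hb => simp [ha, hb]
  let δ' : Derivation (IntermediateField.adjoin C (Set.range x)) F M :=
    Derivation.mk'
      { toFun := δ
        map_add' := δ.map_add
        map_smul' := fun a b => by
          rw [Algebra.smul_def, δ.leibniz]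
          simp [h0 a a.2]
          rfl }
      (fun a b => δ.leibniz a b)
  have : CharZero (IntermediateField.adjoin C (Set.range x)) :=
    charZero_of_injective_algebraMap (algebraMap C _).injective
  have := hx.isAlgebraic_field
  exact δ'.eq_zero_of_isAlgebraic (Algebra.IsAlgebraic.isAlgebraic a)

/-- The derivation of a differential field extends to any separable algebraic extension. -/
theorem exists_differentialAlgebra_of_isSeparable (P Q : Type*) [Field P] [Field Q]
    [Algebra P Q] [Algebra.IsSeparable P Q] [Differential P] :
    ∃ _ : Differential Q, DifferentialAlgebra P Q := by
  have : Algebra.FormallyEtale P Q := Algebra.FormallyEtale.of_isSeparable P Q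
  let δ : Derivation ℤ P P := Differential.deriv
  let e := KaehlerDifferential.tensorKaehlerEquivOfFormallyEtale ℤ P Q
  let g : Q ⊗[P] Ω[P⁄ℤ] →ₗ[Q] Q :=
    LinearMap.liftBaseChange Q ((Algebra.linearMap P Q).comp δ.liftKaehlerDifferential)
  let dQ : Differential Q := ⟨(g.comp e.symm.toLinearMap).compDer (KaehlerDifferential.D ℤ Q)⟩
  refine ⟨dQ, ⟨fun x => ?_⟩⟩
  have := KaehlerDifferential.tensorKaehlerEquivOfFormallyEtale_symm_D_algebraMap ℤ P Q x
  change g (e.symm (KaehlerDifferential.D ℤ Q (algebraMap P Q x))) = algebraMap P Q (δ x)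
  simp [g, e, this]

/-- A nonzero subspace of `Kⁿ` that is stable under coordinatewise differentiation contains a
nonzero vector with constant coordinates. -/
theorem Submodule.exists_constant_vector {K ι : Type*} [Field K] [Fintype ι]
    (D : Derivation ℤ K K) (V : Submodule K (ι → K))
    (hV : ∀ x ∈ V, (fun i => D (x i)) ∈ V) (hne : V ≠ ⊥) :
    ∃ x ∈ V, x ≠ 0 ∧ ∀ i, D (x i) = 0 := by
  classical
  let supp : (ι → K) → Finset ι := fun x => Finset.univ.filter fun i => x i ≠ 0
  obtain ⟨x, ⟨hxV, hx0⟩, hmin⟩ := exists_minimalFor_of_wellFoundedLT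
    (fun x => x ∈ V ∧ x ≠ 0) (fun x => (supp x).card) ((Submodule.ne_bot_iff V).1 hne)
  obtain ⟨i, hi⟩ := Function.ne_iff.1 hx0
  refine ⟨(x i)⁻¹ • x, V.smul_mem _ hxV, smul_ne_zero (inv_ne_zero hi) hx0, ?_⟩
  -- Once the `i`-th coordinate is `1`, differentiation makes the support strictly smaller.
  set z : ι → K := fun j => D (((x i)⁻¹ • x) j) with hz
  have hzV : z ∈ V := hV _ (V.smul_mem _ hxV)
  have hlt : (supp z).card < (supp x).card := by
    refine Finset.card_lt_card (Finset.ssubset_iff_of_subset ?_ |>.2 ⟨i, ?_, ?_⟩)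
    · intro j hj
      simp only [supp, Finset.mem_filter, Finset.mem_univ, true_and] at hj ⊢
      intro h
      exact hj (by simp [hz, h])
    · simpa [supp] using hi
    · have hzi : z i = 0 := by
        have h1 : (x i)⁻¹ * x i = 1 := inv_mul_cancel₀ hi
        simp only [hz, Pi.smul_apply, smul_eq_mul, h1, D.map_one_eq_zero]
      simp [supp, hzi]
  by_contra! hne'
  obtain ⟨j, hj⟩ := hne'
  have hz0 : z ≠ 0 := fun h => hj (congrFun h j)
  exact absurd (hmin ⟨hzV, hz0⟩ hlt.le) (not_le.2 hlt)

end Derivations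

/-! ### Laurent series with the Euler derivation -/

section LaurentSeries

variable {F : Type*} [Field F]

/-- The operator `X d/dX` on Laurent series, which multiplies the `n`-th coefficient by `n`. -/
noncomputable def LaurentSeries.euler : F⸨X⸩ →+ F⸨X⸩ where
  toFun f :=
    { coeff := fun n => (n : F) * f.coeff n
      isPWO_support' := f.isPWO_support.mono fun n hn h => hn (by simp [h]) }
  map_zero' := by ext n; simp
  map_add' f g := by ext n; simp [mul_add]

theorem LaurentSeries.coeff_euler (f : F⸨X⸩) (n : ℤ) : (euler f).coeff n = n * f.coeff n := rfl

theorem LaurentSeries.euler_mul (f g : F⸨X⸩) : euler (f * g) = f * euler g + g * euler f := by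
  ext n
  have hd : ∀ h : F⸨X⸩, (euler h).support ⊆ h.support :=
    fun h n hn h' => hn (by simp [coeff_euler, h'])
  rw [HahnSeries.coeff_add, mul_comm g, HahnSeries.coeff_mul_left' f.isPWO_support (hd f),
    HahnSeries.coeff_mul_right' g.isPWO_support (hd g), coeff_euler, HahnSeries.coeff_mul,
    ← Finset.sum_add_distrib, Finset.mul_sum]
  refine Finset.sum_congr rfl fun ij hij => ?_
  have hn : ij.1 + ij.2 = n := by
    simp only [Finset.mem_antidiagonal] at hij
    exact hij.2.2
  rw [← hn, coeff_euler, coeff_euler]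
  push_cast
  ring

/-- The differential structure given by an additive map that satisfies the Leibniz rule. -/
@[reducible]
def Differential.ofLeibniz {R : Type*} [CommRing R] (d : R →+ R)
    (h : ∀ a b, d (a * b) = a * d b + b * d a) : Differential R where
  deriv := Derivation.mk' d.toIntLinearMap h

/-- The field of Laurent series with the Euler derivation `X d/dX`. -/
@[reducible]
noncomputable def LaurentSeries.eulerDifferential (F : Type*) [Field F] : Differential F⸨X⸩ :=
  Differential.ofLeibniz euler euler_mul

attribute [local instance] LaurentSeries.eulerDifferential

theorem LaurentSeries.coeff_deriv (f : F⸨X⸩) (n : ℤ) :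
    (Differential.deriv f).coeff n = n * f.coeff n := rfl

theorem LaurentSeries.deriv_C (c : F) :
    Differential.deriv (HahnSeries.C c : F⸨X⸩) = 0 := by
  ext n
  rw [coeff_deriv, HahnSeries.C_apply, HahnSeries.coeff_single]
  split_ifs with h <;> simp [h]

/-- The residue of a logarithmic derivative is the order; at `f = 0` both are `0` by convention. -/
theorem LaurentSeries.coeff_zero_logDeriv (f : F⸨X⸩) :
    (Differential.logDeriv f).coeff 0 = (f.order : F) := by
  rcases eq_or_ne f 0 with rfl | hf
  · simp
  set h : F⸨X⸩ := Differential.deriv f - HahnSeries.C (f.order : F) * f with hh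
  have hdiv : Differential.logDeriv f = HahnSeries.C (f.order : F) + h / f := by
    rw [hh, sub_div, Differential.logDeriv, mul_div_cancel_right₀ _ hf]; ring
  have hcoeff : ∀ n ≤ f.order, h.coeff n = 0 := by
    intro n hn
    rw [hh, HahnSeries.coeff_sub, coeff_deriv, HahnSeries.C_mul_eq_smul,
      HahnSeries.coeff_smul, smul_eq_mul]
    rcases hn.eq_or_lt with rfl | hn
    · ring
    · simp [HahnSeries.coeff_eq_zero_of_lt_order hn]
  have h0 : (h / f).coeff 0 = 0 := by
    rcases eq_or_ne h 0 with h0 | h0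
    · simp [h0]
    · apply HahnSeries.coeff_eq_zero_of_lt_order
      have h1 : f.order < h.order := by
        by_contra! hle
        exact HahnSeries.coeff_order_eq_zero.not.2 h0 (hcoeff _ hle)
      have h2 := HahnSeries.order_mul (div_ne_zero h0 hf) hf
      rw [div_mul_cancel₀ _ hf] at h2
      omega
  rw [hdiv, HahnSeries.coeff_add, h0, add_zero, HahnSeries.C_apply, HahnSeries.coeff_single_same]

/-- The variable is transcendental over the coefficient field. -/
theorem LaurentSeries.eq_zero_of_eval₂_single_eq_zero {p : Polynomial F}
    (hp : p.eval₂ HahnSeries.C (HahnSeries.single 1 1 : F⸨X⸩) = 0) : p = 0 := by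
  have h : Polynomial.eval₂RingHom HahnSeries.C (HahnSeries.single 1 1 : F⸨X⸩) =
      (HahnSeries.ofPowerSeries ℤ F).comp Polynomial.coeToPowerSeries.ringHom := by
    apply Polynomial.ringHom_ext <;> simp
  have h' := RingHom.congr_fun h p
  rw [Polynomial.coe_eval₂RingHom, hp] at h'
  exact Polynomial.coe_injective F ((HahnSeries.ofPowerSeries_injective (Γ := ℤ)) (by simpa using h'.symm))

end LaurentSeries

section Norm

open Differential IntermediateField

variable {P E : Type*} [Field P] [Field E] [Algebra P E] [CharZero P]
  [Differential P] [Differential E] [DifferentialAlgebra P E]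
  [FiniteDimensional P E] [IsGalois P E]

theorem Differential.trace_deriv (x : E) :
    Algebra.trace P E (Differential.deriv x) = Differential.deriv (Algebra.trace P E x) := by
  apply (algebraMap P E).injective
  rw [← deriv_algebraMap, trace_eq_sum_automorphisms, trace_eq_sum_automorphisms, map_sum]
  simp [algEquiv_deriv']

theorem Differential.trace_logDeriv {x : E} (hx : x ≠ 0) :
    Algebra.trace P E (logDeriv x) = logDeriv (Algebra.norm P x) := by
  apply (algebraMap P E).injective
  rw [← logDeriv_algebraMap, trace_eq_sum_automorphisms, Algebra.norm_eq_prod_automorphisms,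
    logDeriv_prod _ _ _ (fun σ _ => by simpa using hx)]
  simp [logDeriv, algEquiv_deriv']

end Norm

/-! ### Residues in algebraic extensions of Laurent series -/

section Embedding

/-- Let `t` be transcendental over a copy of `K` in an algebraically closed field `Q`. Any `w ∈ K`
transcendental over `C` can be sent to `t` by an embedding of `K` into `Q` over `C`. -/
theorem exists_algHom_map_transcendental {C K Q : Type*} [Field C] [Field K] [Field Q]
    [Algebra C K] [Algebra C Q] [IsAlgClosed Q] (L : K →ₐ[C] Q) {t : Q}
    (ht : ∀ p : Polynomial K, p.eval₂ (L : K →+* Q) t = 0 → p = 0) {w : K} (hw : Transcendental C w) :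
    ∃ φ : K →ₐ[C] Q, φ w = t := by
  classical
  have ht' : Transcendental L.range t := by
    rintro ⟨p, hp0, hp⟩
    obtain ⟨q, rfl⟩ := Polynomial.map_surjective (L.rangeRestrict : K →+* L.range)
      L.rangeRestrict_surjective p
    rw [Polynomial.aeval_def, Polynomial.eval₂_map] at hp
    exact hp0 (by rw [ht q hp, Polynomial.map_zero])
  obtain ⟨B, hwB, hB⟩ := exists_isTranscendenceBasis_superset (R := C) (s := {w})
    ((algebraicIndependent_singleton_iff (x := fun i : ({w} : Set K) => id (i : K))
      ⟨w, rfl⟩).2 hw)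
  -- Move the basis element `w` to `t` and keep the other ones in the given copy of `K`.
  let w₀ : B := ⟨w, hwB rfl⟩
  let b' : B → Q := fun i => if i = w₀ then t else L i
  have hb'w : b' w₀ = t := by simp [b']
  have hb'L : ∀ i ≠ w₀, b' i = L i := fun i hi => by simp [b', hi]
  have hb' : AlgebraicIndependent C b' := by
    rw [AlgebraicIndependent.iff_transcendental_adjoin_image w₀, hb'w]
    constructor
    · have : (fun j : {j // j ≠ w₀} => b' j) = L ∘ fun j : {j // j ≠ w₀} => ((j : B) : K) := by
        funext j
        exact hb'L j j.2
      rw [this]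
      exact (hB.1.comp _ Subtype.val_injective).map' L.injective
    · refine ht'.of_tower_top_of_subalgebra_le (Algebra.adjoin_le ?_)
      rintro _ ⟨j, hj, rfl⟩
      exact ⟨j, (hb'L j hj).symm⟩
  let R := Algebra.adjoin C (Set.range (Subtype.val : B → K))
  let ψ : R →ₐ[C] Q := (MvPolynomial.aeval b').comp hB.1.aevalEquiv.symm.toAlgHom
  have hψ : Function.Injective ψ := 
    Function.Injective.comp (g := MvPolynomial.aeval b') hb' hB.1.aevalEquiv.symm.injective
  let : Algebra R Q := ψ.toRingHom.toAlgebra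
  have : FaithfulSMul R Q := (faithfulSMul_iff_algebraMap_injective R Q).2 hψ
  have : Algebra.IsAlgebraic R K := hB.isAlgebraic
  let φ : K →ₐ[R] Q := IsAlgClosed.lift
  have hφ : ∀ r : R, φ r = ψ r := φ.commutes
  refine ⟨{ φ.toRingHom with commutes' := fun c => ?_ }, ?_⟩
  · exact (hφ (algebraMap C R c)).trans (ψ.commutes c)
  · have hwR : hB.1.aevalEquiv (MvPolynomial.X w₀) =
        (⟨w, Algebra.subset_adjoin ⟨w₀, rfl⟩⟩ : R) := by
      ext
      simp [w₀]
    have : φ w = t := by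
      refine (hφ ⟨w, Algebra.subset_adjoin ⟨w₀, rfl⟩⟩).trans ?_
      rw [← hwR]
      simp [ψ, hb'w]
    exact this

end Embedding

section Residues

open Differential

attribute [local instance] LaurentSeries.eulerDifferential

/-- Comparison of residues: an exact form has residue `0`, a logarithmic one has integral
residue. -/
theorem LaurentSeries.order_eq_zero_of_sum_logDeriv_eq_deriv {F ι : Type*} [Field F]
    [Fintype ι] {e : ι → F} (he : LinearIndependent ℤ e) {u : ι → F⸨X⸩} {a : F⸨X⸩}
    (h : ∑ j, HahnSeries.C (e j) * Differential.logDeriv (u j) = Differential.deriv a) (j : ι) :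
    (u j).order = 0 := by
  have hcoeff := congrArg (fun f : F⸨X⸩ => f.coeff 0) h
  simp only [HahnSeries.coeff_sum, coeff_deriv, Int.cast_zero, zero_mul, smul_eq_mul,
    HahnSeries.C_mul_eq_smul, HahnSeries.coeff_smul, coeff_zero_logDeriv] at hcoeff
  exact Fintype.linearIndependent_iff.1 he (fun i => (u i).order)
    (by simpa [zsmul_eq_mul, mul_comm] using hcoeff) j

/-- In an algebraic closure of `F((X))`, if a combination of logarithmic derivatives of elements
`u j` with `ℤ`-independent coefficients in `F` is exact, then no `u j` is `X`. Taking traces down to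
`F((X))` from a finite Galois extension replaces each `u j` by its norm, and `X` has norm a positive
power of `X`, which has nonzero order. -/
theorem LaurentSeries.ne_single_of_sum_logDeriv_eq_deriv {F Q ι : Type*} [Field F] [CharZero F]
    [Field Q] [Algebra F⸨X⸩ Q] [IsAlgClosure F⸨X⸩ Q] [Differential Q]
    [DifferentialAlgebra F⸨X⸩ Q]
    [Fintype ι] {e : ι → F} (he : LinearIndependent ℤ e) {u : ι → Q} (hu : ∀ j, u j ≠ 0) {a : Q}
    (h : ∑ j, algebraMap F⸨X⸩ Q (HahnSeries.C (e j)) * Differential.logDeriv (u j) = Differential.deriv a)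
    (j : ι) : u j ≠ algebraMap F⸨X⸩ Q (HahnSeries.single 1 1) := by
  intro hj
  let P := F⸨X⸩
  have : IsAlgClosed Q := IsAlgClosure.isAlgClosed P
  have : Algebra.IsAlgebraic P Q := IsAlgClosure.isAlgebraic
  have : CharZero P := charZero_of_injective_algebraMap (algebraMap F P).injective
  let E₀ : IntermediateField P Q := IntermediateField.adjoin P (insert a (Set.range u))
  have : FiniteDimensional P E₀ := IntermediateField.finiteDimensional_adjoin
    fun x _ => Algebra.IsIntegral.isIntegral x
  let E : IntermediateField P Q := IntermediateField.normalClosure P E₀ Q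
  have hE₀ : E₀ ≤ E := E₀.le_normalClosure
  have : IsGalois P E := ⟨⟩
  have ha : a ∈ E := hE₀ (IntermediateField.subset_adjoin _ _ (Set.mem_insert _ _))
  have hu' : ∀ i, u i ∈ E := fun i =>
    hE₀ (IntermediateField.subset_adjoin _ _ (Set.mem_insert_of_mem _ ⟨i, rfl⟩))
  let a' : E := ⟨a, ha⟩
  let u' : ι → E := fun i => ⟨u i, hu' i⟩
  have hu0 : ∀ i, u' i ≠ 0 := fun i h0 => hu i (congrArg Subtype.val h0)
  have hsum : ∑ i, algebraMap P E (HahnSeries.C (e i)) * Differential.logDeriv (u' i) =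
      Differential.deriv a' := by
    apply (algebraMap E Q).injective
    rw [← deriv_algebraMap, map_sum]
    simp_rw [map_mul, ← logDeriv_algebraMap]
    exact h
  have htr := congrArg (Algebra.trace P E) hsum
  rw [Differential.trace_deriv, map_sum] at htr
  simp_rw [← Algebra.smul_def, map_smul, Differential.trace_logDeriv (hu0 _)] at htr
  have hord := order_eq_zero_of_sum_logDeriv_eq_deriv he htr j
  have huj : u' j = algebraMap P E (HahnSeries.single 1 1) := Subtype.ext hj
  rw [huj, Algebra.norm_algebraMap] at hord
  rw [HahnSeries.single_pow, one_pow, HahnSeries.order_single one_ne_zero] at hord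
  have := Module.finrank_pos (R := P) (M := E)
  simp at hord
  omega

end Residues

/-! ### Exact combinations of logarithmic derivatives -/

section Exactness

/-- An identity between logarithmic and exact forms, tested on the derivations of `K` over `C`,
may be transported along a `C`-embedding of `K` into a differential field with `C` among its
constants. Both sides are elements of `Ω[K⁄C]`, which is separated by derivations into `K`. -/
theorem sum_logDeriv_algHom_eq_deriv {C K Q ι : Type*} [Field C] [Field K] [Field Q]
    [Algebra C K] [Algebra C Q] [Differential Q] [Fintype ι]
    (hC : ∀ c : C, Differential.deriv (algebraMap C Q c) = 0) (φ : K →ₐ[C] Q)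
    {e : ι → C} {w : ι → K} {a : K}
    (h : ∀ δ : Derivation C K K, ∑ j, algebraMap C K (e j) * (δ (w j) / w j) = δ a) :
    ∑ j, algebraMap C Q (e j) * Differential.logDeriv (φ (w j)) = Differential.deriv (φ a) := by
  let d := KaehlerDifferential.D C K
  have hΩ : ∑ j, (algebraMap C K (e j) * (w j)⁻¹) • d (w j) - d a = 0 := by
    rw [← Module.forall_dual_apply_eq_zero_iff K]
    intro f
    have hf := h (f.compDer d)
    simp only [map_sub, map_sum, map_smul, smul_eq_mul]
    rw [sub_eq_zero]
    refine Eq.trans (Finset.sum_congr rfl fun j _ => ?_) hf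
    change algebraMap C K (e j) * (w j)⁻¹ * f (d (w j)) =
      algebraMap C K (e j) * (f (d (w j)) / w j)
    ring
  -- `K` acts on `Q` through `φ`, so that the derivation of `Q` pulls back to one of `K` into `Q`.
  let : Algebra K Q := φ.toRingHom.toAlgebra
  have : IsScalarTower C K Q := IsScalarTower.of_algebraMap_eq fun c => (φ.commutes c).symm
  have hsmul : ∀ (x : K) (q : Q), x • q = φ x * q := fun _ _ => rfl
  let δ : Derivation C K Q :=
    Derivation.mk'
      { toFun := fun x => Differential.deriv (φ x)
        map_add' := fun x y => by simp
        map_smul' := fun c x => by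
          simp [Algebra.smul_def, hC] }
      (fun x y => by simp [hsmul])
  have hδ : ∀ x, δ.liftKaehlerDifferential (d x) = Differential.deriv (φ x) :=
    fun x => δ.liftKaehlerDifferential_comp_D x
  have := congrArg δ.liftKaehlerDifferential hΩ
  simp only [map_sub, map_sum, map_smul, hδ, map_zero, sub_eq_zero, hsmul] at this
  rw [← this]
  refine Finset.sum_congr rfl fun j _ => ?_
  rw [Differential.logDeriv, map_mul, map_inv₀, φ.commutes]
  ring

attribute [local instance] LaurentSeries.eulerDifferential

/-- If a combination `∑ eⱼ dwⱼ/wⱼ` with `ℤ`-independent constants `eⱼ` is exact, every `wⱼ` is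
algebraic over the constants. Otherwise `K` embeds into the algebraic closure of `K((X))` with
`wⱼ ↦ X`, where the residue at `X = 0` prevents exactness. -/
theorem isAlgebraic_of_sum_logDeriv_exact.{u} {C ι : Type*} {K : Type u} [Field C] [Field K] [CharZero K]
    [Algebra C K] [Fintype ι] {e : ι → C} (he : LinearIndependent ℤ e) {w : ι → K}
    (hw : ∀ j, w j ≠ 0) {a : K}
    (h : ∀ δ : Derivation C K K, ∑ j, algebraMap C K (e j) * (δ (w j) / w j) = δ a) (j : ι) :
    IsAlgebraic C (w j) := by
  by_contra hj
  -- `Q` is kept abstract: its `C`-algebra structure, chosen below, is then the only one around.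
  obtain ⟨Q, _, _, _⟩ : ∃ (Q : Type u) (_ : Field Q) (_ : Algebra K⸨X⸩ Q),
      IsAlgClosure K⸨X⸩ Q :=
    ⟨AlgebraicClosure K⸨X⸩, inferInstance, inferInstance, inferInstance⟩
  have : IsAlgClosed Q := IsAlgClosure.isAlgClosed K⸨X⸩
  have : Algebra.IsAlgebraic K⸨X⸩ Q := IsAlgClosure.isAlgebraic
  have : CharZero K⸨X⸩ :=
    charZero_of_injective_ringHom (f := (HahnSeries.C : K →+* K⸨X⸩)) HahnSeries.C_injective
  obtain ⟨_, _⟩ := exists_differentialAlgebra_of_isSeparable K⸨X⸩ Q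
  let ψ : K →+* Q := (algebraMap K⸨X⸩ Q).comp HahnSeries.C
  let : Algebra C Q := (ψ.comp (algebraMap C K)).toAlgebra
  let L : K →ₐ[C] Q := { ψ with commutes' := fun _ => rfl }
  have ht : ∀ p : Polynomial K,
      p.eval₂ (L : K →+* Q) (algebraMap K⸨X⸩ Q (HahnSeries.single 1 1)) = 0 → p = 0 := by
    intro p hp
    refine LaurentSeries.eq_zero_of_eval₂_single_eq_zero
      ((algebraMap K⸨X⸩ Q).injective ?_)
    rw [Polynomial.hom_eval₂, map_zero]
    exact hp
  obtain ⟨φ, hφ⟩ := exists_algHom_map_transcendental L ht hj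
  have hC : ∀ c : C, Differential.deriv (algebraMap C Q c) = 0 := by
    intro c
    change Differential.deriv (algebraMap K⸨X⸩ Q (HahnSeries.C (algebraMap C K c))) = 0
    rw [deriv_algebraMap, LaurentSeries.deriv_C, map_zero]
  have he' : LinearIndependent ℤ fun j => algebraMap C K (e j) :=
    he.map' (algebraMap C K).toAddMonoidHom.toIntLinearMap
      (LinearMap.ker_eq_bot.2 (algebraMap C K).injective)
  exact LaurentSeries.ne_single_of_sum_logDeriv_eq_deriv he' (u := fun j => φ (w j))
    (fun i => by simpa using hw i) (sum_logDeriv_algHom_eq_deriv hC φ h) j hφ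

end Exactness

/-! ### Ax's theorem -/

/-- If `r` factors through `T` and kills a vector that `T` does not, its rank is smaller. -/
theorem LinearMap.finrank_range_lt_of_ker_lt {K V W W' : Type*} [Field K] [AddCommGroup V]
    [Module K V] [AddCommGroup W] [Module K W] [AddCommGroup W'] [Module K W']
    [FiniteDimensional K W] {T : V →ₗ[K] W} {r : V →ₗ[K] W'}
    (h : LinearMap.ker T < LinearMap.ker r) :
    Module.finrank K (LinearMap.range r) < Module.finrank K W := by
  obtain ⟨hle, v, hvr, hvT⟩ := SetLike.lt_iff_le_and_exists.1 h
  let g := (LinearMap.ker T).liftQ r hle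
  have : FiniteDimensional K (V ⧸ LinearMap.ker T) :=
    Module.Finite.equiv T.quotKerEquivRange.symm
  have h1 : Module.finrank K (V ⧸ LinearMap.ker T) ≤ Module.finrank K W :=
    T.quotKerEquivRange.finrank_eq ▸ Submodule.finrank_le _
  have h2 := g.finrank_range_add_finrank_ker
  have h3 : 0 < Module.finrank K (LinearMap.ker g) := by
    rw [Module.finrank_pos_iff_exists_ne_zero]
    refine ⟨⟨(LinearMap.ker T).mkQ v, by simpa [g] using hvr⟩, fun h0 => hvT ?_⟩
    simpa using congrArg Subtype.val h0
  rw [Submodule.range_liftQ] at h2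
  omega

/-- Restricted to a field `F` of transcendence degree at most `n` over `C`, the derivations of `K`
over `C` span a space of dimension at most `n`. A linear map that depends only on this restriction,
and kills a derivation that is nonzero on `F`, therefore has rank less than `n`. -/
theorem Derivation.finrank_range_lt_of_trdeg_lt {C K W : Type*} [Field C] [CharZero C] [Field K]
    [Algebra C K] [AddCommGroup W] [Module K W] {F : IntermediateField C K} {n : ℕ}
    (htr : Algebra.trdeg C F < ((n + 1 : ℕ) : Cardinal)) {r : Derivation C K K →ₗ[K] W}
    (hr : ∀ δ : Derivation C K K, (∀ a ∈ F, δ a = 0) → r δ = 0) {δ₀ : Derivation C K K}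
    (h₀ : r δ₀ = 0) {a : K} (ha : a ∈ F) (hδ₀ : δ₀ a ≠ 0) :
    Module.finrank K (LinearMap.range r) < n := by
  obtain ⟨s, hs⟩ := exists_isTranscendenceBasis C F
  rw [← hs.cardinalMk_eq_trdeg] at htr
  have : Finite s := Cardinal.lt_aleph0_iff_finite.1 (htr.trans Cardinal.natCast_lt_aleph0)
  have := Fintype.ofFinite s
  rw [Cardinal.mk_fintype, Nat.cast_lt, Nat.lt_succ_iff] at htr
  let T : Derivation C K K →ₗ[K] (s → K) :=
    { toFun := fun δ i => δ ((i : F) : K)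
      map_add' := fun _ _ => rfl
      map_smul' := fun _ _ => rfl }
  have hT : ∀ δ, T δ = 0 → ∀ a ∈ F, δ a = 0 := fun δ hδ a ha =>
    (δ.compAlgebraMap F).eq_zero_of_isTranscendenceBasis hs (fun i => congrFun hδ i) ⟨a, ha⟩
  have hker : LinearMap.ker T < LinearMap.ker r :=
    SetLike.lt_iff_le_and_exists.2
      ⟨fun δ hδ => hr δ (hT δ hδ), δ₀, h₀, fun hD => hδ₀ (hT _ hD _ ha)⟩
  refine (LinearMap.finrank_range_lt_of_ker_lt hker).trans_le ?_
  simpa using htr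

namespace DiffValExpField

variable {K : Type*} [Field K] [CharZero K] {Γ₀ : Type*} [LinearOrderedCommGroupWithZero Γ₀]
  (S : DiffValExpField K Γ₀)

/-- The derivation `D`, as a derivation over the field of constants. -/
def constDerivation : Derivation S.constants K K :=
  Derivation.mk'
    { toFun := S.D
      map_add' := S.D.map_add
      map_smul' := fun c x => by
        have hc : S.D (c : K) = 0 := c.2
        simp [Subfield.smul_def, hc] }
    (fun x y => S.D.leibniz x y)

@[simp]
theorem constDerivation_apply (x : K) : S.constDerivation x = S.D x := rfl

/-- For a derivation `δ`, the additive map `x ↦ δ (exp x) / exp x`. -/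
def logDerivExp (δ : Derivation S.constants K K) : K →+ K :=
  AddMonoidHom.mk' (fun x => δ (S.exp x : K) / (S.exp x : K)) fun x y => by
    have hx := (S.exp x).ne_zero
    have hy := (S.exp y).ne_zero
    rw [S.exp_add, Units.val_mul, δ.leibniz, smul_eq_mul, smul_eq_mul]
    field_simp
    ring

theorem logDerivExp_apply (δ : Derivation S.constants K K) (x : K) :
    S.logDerivExp δ x = δ (S.exp x : K) / (S.exp x : K) := rfl

/-- The pairing of derivations with the forms `dyᵢ - dzᵢ/zᵢ`, where `zᵢ = exp yᵢ`. -/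
def expDefect {ι : Type*} (y : ι → K) : Derivation S.constants K K →ₗ[K] (ι → K) where
  toFun δ i := δ (y i) - S.logDerivExp δ (y i)
  map_add' δ δ' := by
    funext i
    simp only [logDerivExp_apply, Derivation.add_apply, Pi.add_apply]
    ring
  map_smul' a δ := by
    funext i
    simp only [logDerivExp_apply, Derivation.smul_apply, Pi.smul_apply, smul_eq_mul,
      RingHom.id_apply]
    ring

theorem expDefect_apply {ι : Type*} (y : ι → K) (δ : Derivation S.constants K K) (i : ι) :
    S.expDefect y δ i = δ (y i) - δ (S.exp (y i) : K) / (S.exp (y i) : K) := rfl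

theorem expDefect_constDerivation {ι : Type*} (y : ι → K) :
    S.expDefect y S.constDerivation = 0 := by
  funext i
  exact sub_eq_zero.2 (S.D_eq_logDeriv_exp (y i))

/-- The forms `dyᵢ - dzᵢ/zᵢ` have zero Lie derivative along `D`. -/
theorem expDefect_lie {ι : Type*} (y : ι → K) (δ : Derivation S.constants K K) (i : ι) :
    S.expDefect y ⁅S.constDerivation, δ⁆ i = S.D (S.expDefect y δ i) := by
  have hz := (S.exp (y i)).ne_zero
  have h := congrArg δ (S.D_eq_logDeriv_exp (y i))
  simp only [expDefect_apply, Derivation.commutator_apply, constDerivation_apply, map_sub,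
    Derivation.leibniz_div, smul_eq_mul] at h ⊢
  rw [h]
  field_simp
  ring

theorem finrank_range_expDefect_lt {n : ℕ} (y : Fin n → K) (hy : ∃ i, S.D (y i) ≠ 0)
    (htr : Algebra.trdeg S.constants (IntermediateField.adjoin S.constants
      (Set.range y ∪ Set.range (fun i => (S.exp (y i) : K)))) < ((n + 1 : ℕ) : Cardinal)) :
    Module.finrank K (LinearMap.range (S.expDefect y)) < n := by
  have hyF := fun i => IntermediateField.subset_adjoin S.constants
    (Set.range y ∪ Set.range (fun i => (S.exp (y i) : K))) (Or.inl ⟨i, rfl⟩ : y i ∈ _)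
  have hzF := fun i => IntermediateField.subset_adjoin S.constants
    (Set.range y ∪ Set.range (fun i => (S.exp (y i) : K)))
    (Or.inr ⟨i, rfl⟩ : (S.exp (y i) : K) ∈ _)
  obtain ⟨i, hi⟩ := hy
  refine Derivation.finrank_range_lt_of_trdeg_lt htr (fun δ hδ => ?_)
    (S.expDefect_constDerivation y) (hyF i) hi
  funext i
  simp [expDefect_apply, hδ _ (hyF i), hδ _ (hzF i)]

/-- If the span of the forms `dyᵢ - dzᵢ/zᵢ` is not of full dimension, they are linearly dependent
over the constants. -/
theorem exists_constant_relation {n : ℕ} (y : Fin n → K)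
    (h : Module.finrank K (LinearMap.range (S.expDefect y)) < n) :
    ∃ c : Fin n → S.constants, c ≠ 0 ∧
      ∀ δ : Derivation S.constants K K, ∑ i, (c i : K) * S.expDefect y δ i = 0 := by
  -- The space of linear relations between the forms.
  let V : Submodule K (Fin n → K) :=
    { carrier := {x | ∀ δ, ∑ i, x i * S.expDefect y δ i = 0}
      add_mem' := fun {a b} ha hb δ => by
        simp only [Pi.add_apply, add_mul, Finset.sum_add_distrib, ha δ, hb δ, add_zero]
      zero_mem' := fun δ => by simp
      smul_mem' := fun a x hx δ => by
        simp only [Pi.smul_apply, smul_eq_mul, mul_assoc, ← Finset.mul_sum, hx δ, mul_zero] }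
  have hne : V ≠ ⊥ := by
    have hlt : LinearMap.range (S.expDefect y) < ⊤ := by
      refine lt_top_iff_ne_top.2 fun htop => ?_
      rw [htop, finrank_top, Module.finrank_fin_fun] at h
      exact lt_irrefl _ h
    obtain ⟨f, hf0, hf⟩ := Submodule.exists_le_ker_of_lt_top _ hlt
    have hfx : ∀ x, f x = ∑ i, f (Pi.single i 1) * x i := fun x => by
      conv_lhs => rw [pi_eq_sum_univ' x, map_sum]
      refine Finset.sum_congr rfl fun i _ => ?_
      rw [map_smul, smul_eq_mul, mul_comm]
    refine (Submodule.ne_bot_iff V).2 ⟨fun i => f (Pi.single i 1), fun δ => ?_, fun h0 => hf0 ?_⟩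
    · rw [← hfx]
      exact hf ⟨δ, rfl⟩
    · refine LinearMap.ext fun x => ?_
      rw [hfx]
      simp [fun i => congrFun h0 i]
  have hV : ∀ x ∈ V, (fun i => S.D (x i)) ∈ V := by
    intro x hx δ
    have h1 := congrArg S.D (hx δ)
    have h2 := hx ⁅S.constDerivation, δ⁆
    simp only [expDefect_lie] at h2
    simp only [map_sum, Derivation.leibniz, smul_eq_mul, Finset.sum_add_distrib, h2, zero_add,
      map_zero] at h1
    simpa only [mul_comm] using h1
  obtain ⟨x, hxV, hx0, hxc⟩ := Submodule.exists_constant_vector S.D V hV hne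
  refine ⟨fun i => ⟨x i, hxc i⟩, fun h0 => hx0 ?_, hxV⟩
  funext i
  exact congrArg Subtype.val (congrFun h0 i)

/-- **Ax's theorem** for one derivation. The hypothesis says that the `yᵢ` are `ℚ`-linearly
independent modulo the constants. -/
theorem le_trdeg_adjoin_exp {n : ℕ} (hn : 1 ≤ n) (y : Fin n → K)
    (hy : ∀ m : Fin n → ℤ, S.D (∑ i, m i • y i) = 0 → m = 0) :
    ((n + 1 : ℕ) : Cardinal) ≤
      Algebra.trdeg S.constants
        (IntermediateField.adjoin S.constants
          (Set.range y ∪ Set.range (fun i => (S.exp (y i) : K)))) := by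
  by_contra! htr
  have hDy : ∃ i, S.D (y i) ≠ 0 := by
    by_contra! h0
    have := congrFun (hy 1 (by simp [h0])) ⟨0, hn⟩
    simp at this
  obtain ⟨c, hc0, hc⟩ :=
    S.exists_constant_relation y (S.finrank_range_expDefect_lt y hDy htr)
  -- Rewrite the relation with the `ℤ`-basis `e` of the group generated by its coefficients.
  let M := Submodule.span ℤ (Set.range c)
  have : Module.Finite ℤ M := Module.Finite.span_of_finite ℤ (Set.finite_range c)
  let b := Module.Free.chooseBasis ℤ M
  let c' : Fin n → M := fun i => ⟨c i, Submodule.subset_span ⟨i, rfl⟩⟩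
  let e : Module.Free.ChooseBasisIndex ℤ M → S.constants := fun j => b j
  have he : LinearIndependent ℤ e := b.linearIndependent.map' M.subtype (Submodule.ker_subtype M)
  let m : Module.Free.ChooseBasisIndex ℤ M → Fin n → ℤ := fun j i => b.repr (c' i) j
  have hcm : ∀ i, (c i : K) = ∑ j, (e j : K) * (m j i : K) := fun i => by
    have h1 := congrArg (fun x : M => ((x : S.constants) : K)) (b.sum_repr (c' i))
    simp only [AddSubmonoidClass.coe_finsetSum] at h1
    refine h1.symm.trans (Finset.sum_congr rfl fun j _ => ?_)
    simp [m, e, zsmul_eq_mul, mul_comm]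
  let u : Module.Free.ChooseBasisIndex ℤ M → K := fun j => ∑ i, m j i • y i
  have hrel : ∀ δ : Derivation S.constants K K,
      ∑ j, algebraMap S.constants K (e j) * (δ (S.exp (u j) : K) / (S.exp (u j) : K)) =
        δ (∑ i, c i • y i) := by
    intro δ
    have h1 : ∀ j, δ (S.exp (u j) : K) / (S.exp (u j) : K) =
        ∑ i, (m j i : K) * S.logDerivExp δ (y i) := fun j => by
      rw [← logDerivExp_apply]
      simp only [u, map_sum, map_zsmul]
      simp only [zsmul_eq_mul]
    have h2 : ∑ i, (c i : K) * S.logDerivExp δ (y i) = δ (∑ i, c i • y i) := by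
      have h3 := hc δ
      simp only [expDefect_apply, mul_sub, Finset.sum_sub_distrib, sub_eq_zero] at h3
      simp only [map_sum, Derivation.map_smul]
      exact h3.symm
    rw [← h2]
    simp only [h1, hcm, Finset.mul_sum, Finset.sum_mul]
    rw [Finset.sum_comm]
    refine Finset.sum_congr rfl fun i _ => Finset.sum_congr rfl fun j _ => ?_
    exact (mul_assoc _ _ _).symm
  have hm : ∀ j, m j = 0 := fun j => by
    refine hy _ ?_
    have hD := S.constDerivation.eq_zero_of_isAlgebraic
      (isAlgebraic_of_sum_logDeriv_exact he (fun j => (S.exp (u j)).ne_zero) hrel j)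
    rw [constDerivation_apply] at hD
    rw [S.D_eq_logDeriv_exp]
    exact (congrArg (· / _) hD).trans (zero_div _)
  refine hc0 (funext fun i => Subtype.ext ?_)
  rw [hcm]
  simp [hm]

theorem D_co (A : Submodule ℚ K) (hA : IsCompl A S.valuationRing) (y : K) :
    S.D (S.co A hA y : K) = 0 := (S.co A hA y).2

theorem residue_eq_of_constant {y : S.valuationRing} {c : K} (hc : S.D c = 0)
    (h : S.v (y - c) < 1) : (S.residue y : K) = c :=
  (S.existsUnique_constant y y.2).unique (S.existsUnique_constant y y.2).choose_spec.1 ⟨hc, h⟩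

theorem v_sub_residue_lt_one (y : S.valuationRing) : S.v (y - S.residue y) < 1 :=
  (S.existsUnique_constant y y.2).choose_spec.1.2

theorem co_add (A : Submodule ℚ K) (hA : IsCompl A S.valuationRing) (x y : K) :
    S.co A hA (x + y) = S.co A hA x + S.co A hA y := by
  refine Subtype.ext (S.residue_eq_of_constant (by simp [D_co]) ?_)
  have hx := S.v_sub_residue_lt_one (Submodule.projectionOnto S.valuationRing A hA.symm x)
  have hy := S.v_sub_residue_lt_one (Submodule.projectionOnto S.valuationRing A hA.symm y)
  refine lt_of_eq_of_lt (congrArg S.v ?_) (S.v.map_add_lt hx hy)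
  simp only [map_add, Submodule.coe_add, co, Subfield.coe_add]
  ring

theorem co_of_constant (A : Submodule ℚ K) (hA : IsCompl A S.valuationRing) {c : K}
    (hc : S.D c = 0) : (S.co A hA c : K) = c := by
  have h : ((Submodule.projectionOnto S.valuationRing A hA.symm c : S.valuationRing) : K) = c :=
    congrArg Subtype.val (Submodule.projectionOnto_apply_left hA.symm
      (⟨c, S.constant_mem c hc⟩ : S.valuationRing))
  exact S.residue_eq_of_constant hc (by simp [h])

/-- `y ↦ y - co_A(y)` as an additive map: the projection of `K` to `A ⊕ 𝓜_v` along `C`. -/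
noncomputable def subCo (A : Submodule ℚ K) (hA : IsCompl A S.valuationRing) : K →+ K :=
  AddMonoidHom.mk' (fun y => y - S.co A hA y) fun x y => by
    rw [co_add, Subfield.coe_add]
    ring

end DiffValExpField

theorem mainTheorem1 {K : Type*} [Field K] [CharZero K]
    {Γ₀ : Type*} [LinearOrderedCommGroupWithZero Γ₀] (S : DiffValExpField K Γ₀)
    (A : Submodule ℚ K) (hA : IsCompl A S.valuationRing)
    (n : ℕ) (hn : 1 ≤ n) (y : Fin n → K)
    (hy : LinearIndependent ℚ (fun i => y i - (S.co A hA (y i) : K))) :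
    ((n + 1 : ℕ) : Cardinal) ≤
      Algebra.trdeg S.constants
        (IntermediateField.adjoin S.constants
          (Set.range y ∪ Set.range (fun i => (S.exp (y i) : K)))) := by
  refine S.le_trdeg_adjoin_exp hn y fun m hm => ?_
  have h0 : ∑ i, m i • (y i - (S.co A hA (y i) : K)) = 0 := by
    have h1 : S.subCo A hA (∑ i, m i • y i) = 0 :=
      sub_eq_zero.2 (S.co_of_constant A hA hm).symm
    rw [map_sum] at h1
    simp only [map_zsmul] at h1
    exact h1
  have hyZ : LinearIndependent ℤ (fun i => y i - (S.co A hA (y i) : K)) :=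
    hy.restrict_scalars' ℤ
  exact funext (Fintype.linearIndependent_iff.1 hyZ m h0)
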